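/- Let $\mathcal P(3^3)$ be the graph whose vertices are the partitions of $\{1,\dots,9\}$ into three cells of size three, two such partitions being adjacent when they are skew, that is, when each triple of one partition contains exactly one point from each triple of the other. Then $\mathcal P(3^3)$ has $280$ vertices and is a core: every endomorphism of $\mathcal P(3^3)$ (every map from its vertex set to itself that sends adjacent vertices to adjacent vertices) is an automorphism of $\mathcal P(3^3)$. -/

import Mathlib

/-- The partitions of a nine-element set (here `Fin 9`) with three cells of size three. -/
abbrev TriplePartition : Type :=
  {P : Finpartition (Finset.univ : Finset (Fin 9)) //
    P.parts.card = 3 ∧ ∀ c ∈ P.parts, c.card = 3}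

/-- Two partitions into triples are skew if each triple of one contains exactly one point of
each triple of the other. -/
def TriplePartition.Skew (P Q : TriplePartition) : Prop :=
  ∀ a ∈ P.1.parts, ∀ b ∈ Q.1.parts, (a ∩ b).card = 1

/-- The graph on the partitions of a nine-element set into three triples, where adjacency
is skewness. -/
def skewGraph : SimpleGraph TriplePartition where
  Adj := TriplePartition.Skew
  symm := ⟨fun _ _ h a ha b hb => by
    rw [Finset.inter_comm]
    exact h b hb a ha⟩
  loopless := ⟨fun P h => by
    obtain ⟨a, ha⟩ := Finset.card_pos.mp (by rw [P.2.1]; norm_num : 0 < P.1.parts.card)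
    have h1 := h a ha a ha
    rw [Finset.inter_self, P.2.2 a ha] at h1
    norm_num at h1⟩

/-- A graph is a core if each of its endomorphisms is an automorphism. -/
def SimpleGraph.IsCore {V : Type*} (G : SimpleGraph V) : Prop :=
  ∀ f : G →g G, ∃ φ : G ≃g G, ∀ v, φ v = f v

/-! For a pair `e` of points let `S e` be the set of partitions with a cell containing `e`. Each `S
e` has exactly one member in every clique of size four: in such a clique the cells through a point
`x` pairwise share only `x`, so their remaining points fill up the other eight
(`meetsCliques_covers`). Conversely, every set of partitions with exactly one member in each such
clique is some `S e` (`MeetsCliques.exists_iff_covers`). This converse rests on a finite case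
analysis, stored as the tree `cliqueSearch` and evaluated by the kernel.

An endomorphism `f` sends cliques of size four to cliques of size four, so the preimage of `S e`
again has one member in each, hence is `S (g e)` for some pair `g e`. The map `g` is injective: for
`e ≠ e'` there is a pair `d` such that no partition covers `e`, `e'` and `d`, whereas if `g e = g
e'`, a partition covering both `g e` and `g d` would be mapped by `f` to one that does. So `g` is a
permutation of the pairs. If `f P = f Q`, then `P` and `Q` cover the same pairs and are equal. Thus
`f` is injective, and by finiteness an automorphism. -/

/-! ### Partitions coded as natural numbers -/

/-- The subset of `Fin 9` whose indicator has the binary expansion `m`. -/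
def maskSet (m : ℕ) : Finset (Fin 9) :=
  Finset.univ.filter fun i => m.testBit i

/-- The masks of the three-element subsets of `Fin 9`. -/
def tripleMasks : List ℕ :=
  (List.range 512).filter fun m => decide ((maskSet m).card = 3)

/-- The code of a partition into three cells with the given masks. -/
def packCode (x y z : ℕ) : ℕ := x * 262144 + y * 512 + z

/-- The first cell of a code. -/
def cellA (q : ℕ) : ℕ := Nat.div q 262144

/-- The second cell of a code. -/
def cellB (q : ℕ) : ℕ := Nat.mod (Nat.div q 512) 512

/-- The third cell of a code. -/
def cellC (q : ℕ) : ℕ := Nat.mod q 512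

/-- Two masks share a bit. -/
def masksMeet (x y : ℕ) : Bool := !(Nat.beq (Nat.land x y) 0)

/-- One code for each partition into triples: the first cell contains `0`,
the other two are in increasing order. -/
def partitionCodes : List ℕ :=
  (tripleMasks.filter fun x => masksMeet x 1).flatMap fun x =>
    (tripleMasks.filter fun y => !masksMeet x y).flatMap fun y =>
      (tripleMasks.filter fun z => Nat.blt y z && (!masksMeet x z && !masksMeet y z)).map fun z =>
        packCode x y z

/-- All cells of the first code meet all cells of the second. -/
def codesSkew (p q : ℕ) : Bool :=
  masksMeet (cellA p) (cellA q) && (masksMeet (cellB p) (cellB q) &&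
  (masksMeet (cellA p) (cellB q) && (masksMeet (cellB p) (cellA q) &&
  (masksMeet (cellC p) (cellC q) && (masksMeet (cellA p) (cellC q) &&
  (masksMeet (cellC p) (cellA q) && (masksMeet (cellB p) (cellC q) &&
  masksMeet (cellC p) (cellB q))))))))

/-- Some cell of the code contains the mask. -/
def codeCovers (m q : ℕ) : Bool :=
  Nat.beq (Nat.land (cellA q) m) m || (Nat.beq (Nat.land (cellB q) m) m ||
    Nat.beq (Nat.land (cellC q) m) m)

/-- List membership for natural numbers. -/
def natMem (q : ℕ) (L : List ℕ) : Bool := L.any fun r => Nat.beq q r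

/-- Four codes of pairwise skew partitions. -/
def codesClique (a b c d : ℕ) : Bool :=
  (natMem a partitionCodes && (natMem b partitionCodes &&
    (natMem c partitionCodes && natMem d partitionCodes))) &&
  (codesSkew a b && (codesSkew a c && (codesSkew a d &&
    (codesSkew b c && (codesSkew b d && codesSkew c d)))))

/-- Remove the codes skew to a given one. -/
def dropSkew (a : ℕ) (L : List ℕ) : List ℕ := L.filter fun q => !codesSkew a q

/-! ### The case analysis and its checker -/

/-- A case analysis over the sets of partitions that contain exactly one member
of each clique of size four. -/
inductive CliqueSearch : Type
  /-- All remaining partitions have a cell containing the given pair. -/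
  | leaf (m : ℕ) : CliqueSearch
  /-- The first member of a clique is chosen, as the other three are excluded. -/
  | forced (a b c d : ℕ) (t : CliqueSearch) : CliqueSearch
  /-- One of the four members of a clique is chosen. -/
  | branch (a b c d : ℕ) (ta tb tc td : CliqueSearch) : CliqueSearch

/-- Correctness of a case analysis, where `L` holds the partitions not yet excluded. -/
def CliqueSearch.check : CliqueSearch → List ℕ → Bool
  | .leaf m, L => decide ((maskSet m).card = 2) && L.all fun q => codeCovers m q
  | .forced a b c d t, L =>
      codesClique a b c d && (!natMem b L && (!natMem c L && (!natMem d L &&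
        t.check (dropSkew a L))))
  | .branch a b c d ta tb tc td, L =>
      codesClique a b c d && ((!natMem a L || ta.check (dropSkew a L)) &&
        ((!natMem b L || tb.check (dropSkew b L)) && ((!natMem c L || tc.check (dropSkew c L)) &&
          (!natMem d L || td.check (dropSkew d L)))))

/-! ### Finite computations -/

/-- The masks of the two-element subsets of `Fin 9`. -/
def pairMasks : List ℕ :=
  (List.range 512).filter fun m => decide ((maskSet m).card = 2)

theorem length_partitionCodes : partitionCodes.length = 280 := by decide +kernel

theorem nodup_partitionCodes : partitionCodes.Nodup := by
  -- The list is generated in strictly increasing order, so comparing neighbours suffices.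
  refine (List.sortedLT_iff_pairwise.mpr ?_).nodup
  exact List.isChain_iff_pairwise.mp (by decide +kernel)

/-- Every code lies in a clique of size four. -/
theorem exists_codes_clique :
    (partitionCodes.all fun a => (partitionCodes.filter (codesSkew a)).any fun b =>
      ((partitionCodes.filter (codesSkew a)).filter (codesSkew b)).any fun c =>
        ((partitionCodes.filter (codesSkew a)).filter (codesSkew b)).any fun d =>
          codesSkew c d) = true := by
  decide +kernel

/-- Any two pairs are covered by the cells of some code. -/
theorem exists_code_covers_pairs :
    (pairMasks.all fun m => pairMasks.all fun n =>
      (partitionCodes.filter (codeCovers m)).any (codeCovers n)) = true := by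
  decide +kernel

/-- A case analysis that covers all sets of partitions meeting each clique of size four once. -/
def cliqueSearch : CliqueSearch :=
  (.branch 1892744 19211556 71587012 42219842 (.branch 34384168 3433920 71603364 25506054 (.branch
  67938472 34915608 19211556 12852672 (.forced 9218440 68433120 19205424 38033730 (.branch 34392344
  3433920 21319942 75797652 (.forced 67922120 34915608 10822980 21241248 (.forced 2910656 68461736
  38050082 25496856 (.forced 67946648 34907432 19219732 12852672 (.branch 2984240 68472978 21253512
  42219842 (.forced 67909856 34903344 10822980 21253512 (.forced 5065032 68441296 35949872 25442690
  (.forced 17592708 9774408 35957026 71572704 (.forced 1921360 19162500 38062346 75774146 (.forced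
  9277716 34894146 69519506 21241248 (.forced 9214352 34878816 69494978 21319942 (.leaf 3)))))))
  (.leaf 3) (.forced 12916036 67909856 34907432 19156368 (.branch 34394388 18166050 69510308
  12852672 (.leaf 3) (.leaf 3) (.leaf 3) (.leaf 3))) (.leaf 3))))) (.leaf 3) (.forced 3450272
  34367816 71587012 25506054 (.forced 34907432 67946648 19219732 12852672 (.forced 21241248 67922120
  34915608 10822980 (.branch 1937712 10790276 38062346 84162722 (.forced 18109840 34355552 69510308
  12947718 (.branch 67934384 9798936 35925344 21255556 (.leaf 3) (.leaf 3) (.leaf 3) (.leaf 3)))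
  (.forced 69511330 1937712 38033730 25441668 (.forced 75766992 17592708 5588296 35965202 (.forced
  67940516 18113928 10847508 38018400 (.forced 9770320 67909856 19162500 38047016 (.forced 34398476
  9777474 19148192 71587012 (.forced 68441296 34355552 19220754 12881288 (.leaf 80))))))) (.leaf 3)
  (.leaf 3))))) (.leaf 3))) (.forced 12913992 67938472 3458448 50607396 (.forced 34907432 67946648
  19219732 12852672 (.forced 34392344 68461736 19212578 12852672 (.forced 34367816 68469912 10848530
  21241248 (.forced 21302568 9189824 68457648 35965202 (.branch 5095692 34910498 10784144 84174986
  (.forced 12881288 67909856 34886992 19211556 (.forced 69510308 34394388 18166050 12852672 (.forced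
  38030664 67909856 18158896 10790276 (.forced 69494978 9253188 34918674 21241248 (.forced 18171160
  67948692 35956004 12852672 (.forced 17590664 68464802 10848530 38018400 (.leaf 264))))))) (.forced
  34355552 68441296 19220754 12881288 (.forced 19205424 67909856 9741704 38032708 (.forced 1921360
  69494978 38050082 25441668 (.forced 34878816 67918032 19219732 12881288 (.branch 17592708 3482976
  71584968 42248458 (.forced 18171160 67918032 35925344 12883332 (.branch 67948692 18101664 35933520
  12944652 (.leaf 3) (.leaf 3) (.leaf 3) (.leaf 3))) (.forced 38030664 67924164 3450272 25498900
  (.branch 67940516 18158896 10759616 38061324 (.leaf 3) (.leaf 3) (.leaf 3) (.leaf 3))) (.leaf 3)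
  (.leaf 3)))))) (.leaf 3) (.leaf 3))))))) (.leaf 3) (.leaf 3)) (.branch 9189824 68477066 19220754
  38047016 (.forced 10759616 17647896 68477066 38050082 (.forced 1864128 69510308 38050082 25498900
  (.branch 5020064 34922762 10847508 84167832 (.forced 5558658 17635632 69487824 42218820 (.forced
  18101664 9247056 69494978 38064390 (.forced 25435536 67922120 34907432 6636868 (.forced 17592708
  5607714 69519506 42212688 (.forced 12884354 17647896 68441296 35925344 (.forced 100947028 17641764
  3522834 12913992 (.forced 19156368 67938472 34878816 12944652 (.leaf 384)))))))) (.leaf 3) (.leaf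
  3) (.forced 9281804 5558658 35949872 84161700 (.forced 34363728 68469912 19148192 12945674
  (.branch 67940516 3507504 38032708 25439624 (.leaf 3) (.leaf 3) (.leaf 3) (.leaf 3))))))) (.forced
  34922762 9189824 19211556 71601320 (.branch 34384168 68433120 19156368 12917058 (.leaf 3) (.forced
  68464802 17635632 10759616 38062346 (.forced 34915608 67938472 19211556 12852672 (.forced 34903344
  67918032 6636868 25439624 (.forced 18109840 34386212 69479648 12917058 (.forced 9802002 17578400
  69525638 38032708 (.forced 18166050 34394388 69510308 12852672 (.forced 5604648 67952780 19156368
  42218820 (.forced 9737616 67909856 35939652 21302568 (.forced 18101664 34363728 69518484 12947718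
  (.leaf 5)))))))))) (.leaf 3) (.forced 35949872 9189824 68472978 21317898 (.forced 69493956 1880480
  38033730 25498900 (.forced 17590664 68464802 10848530 38018400 (.forced 12852672 17649940 34910498
  69519506 (.forced 2974020 34907432 71584968 25442690 (.forced 68448450 9251144 35965202 21241248
  (.forced 67922120 34915608 10822980 21241248 (.forced 34891080 67946648 10847508 21241248 (.leaf
  48))))))))))) (.leaf 3) (.leaf 3)) (.leaf 3) (.branch 34392344 3433920 21319942 75797652 (.forced
  3458448 34367816 21319942 75773124 (.forced 34915608 67938472 19211556 12852672 (.forced 67946648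
  34907432 19219732 12852672 (.forced 25435536 67922120 34907432 6636868 (.branch 1925448 6654242
  25498900 100948050 (.forced 17578400 68441296 35965202 12913992 (.branch 67924164 9774408 35964180
  21241248 (.leaf 3) (.leaf 3) (.leaf 3) (.leaf 3))) (.leaf 3) (.forced 69519506 1864128 21305634
  42243348 (.forced 34878816 17649940 69487824 12884354 (.forced 71572704 17590664 34910498 10822980
  (.forced 5034372 18166050 69494978 42212688 (.forced 34398476 9777474 19148192 71587012 (.forced
  35925344 67918032 18171160 12883332 (.leaf 96))))))) (.leaf 3)))))) (.leaf 3) (.forced 35971334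
  9214352 5604648 84161700 (.branch 1864128 69510308 38050082 25498900 (.forced 1949976 10822980
  21305634 100952138 (.forced 10854662 17578400 34891080 71616650 (.forced 1921360 19163522 38061324
  75773124 (.forced 38064390 9189824 18158896 69510308 (.branch 17590664 34910498 10822980 71572704
  (.leaf 3) (.forced 9253188 34903344 69479648 21256578 (.branch 9189824 34918674 69504176 21304612
  (.leaf 3) (.leaf 3) (.leaf 3) (.leaf 3))) (.leaf 3) (.forced 69487824 5020064 34894146 25498900
  (.forced 21241248 34394388 9777474 69493956 (.forced 10784144 34355552 68445384 21317898 (.forced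
  25496856 67922120 3450272 38032708 (.forced 35925344 67918032 18171160 12883332 (.forced 38030664
  67909856 18158896 10790276 (.leaf 6)))))))))))) (.leaf 3) (.leaf 3) (.forced 21305634 1864128
  69519506 42243348 (.forced 12881288 67918032 34878816 19219732 (.forced 12916036 17586576 34910498
  69479648 (.branch 9189824 18158896 69510308 38064390 (.leaf 3) (.forced 9247056 18101664 69494978
  38064390 (.forced 71584968 34355552 18178314 10790276 (.forced 9777474 34398476 19148192 71587012
  (.forced 35964180 67924164 9774408 21241248 (.forced 67938472 34915608 19211556 12852672 (.forced
  68469912 34384168 19220754 12852672 (.leaf 136))))))) (.leaf 3) (.forced 10790276 67909856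
  18158896 38030664 (.branch 17590664 68464802 10848530 38018400 (.leaf 3) (.leaf 3) (.leaf 3)
  (.leaf 3))))))))) (.leaf 3))) (.branch 17635632 68472978 6573504 42248458 (.branch 67952780
  5543328 10822980 50613528 (.leaf 3) (.forced 2959712 9744770 71601320 50619660 (.forced 19212578
  34392344 68461736 12852672 (.forced 17641764 34886992 69479648 12884354 (.forced 2984240 68472978
  21253512 42219842 (.branch 5083428 34922762 10784144 84162722 (.forced 18101664 34363728 69518484
  12947718 (.forced 34907432 67922120 6636868 25435536 (.forced 1913184 19163522 71587012 42247436
  (.forced 35957026 1864128 71603364 25502988 (.forced 18162984 67909856 35933520 12883332 (.forced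
  34878816 67918032 19219732 12881288 (.leaf 288))))))) (.leaf 3) (.forced 67934384 34915608
  10759616 21304612 (.forced 18162984 67940516 35964180 12852672 (.branch 67918032 18171160 35925344
  12883332 (.leaf 3) (.leaf 3) (.leaf 3) (.leaf 3)))) (.leaf 3)))))) (.leaf 3) (.forced 25498900
  5020064 34894146 69487824 (.forced 19148192 67918032 34915608 12916036 (.forced 18174226 34398476
  6573504 75797652 (.forced 18116994 9247056 69479648 38049060 (.forced 84161700 1941800 35964180
  12884354 (.forced 21316876 67948692 9713088 35949872 (.forced 17639720 68464802 35965202 12852672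
  (.forced 50608418 5065032 68477066 10784144 (.leaf 65)))))))))) (.branch 67938472 3482976 12883332
  50613528 (.leaf 3) (.forced 84170898 9277716 34922762 6589856 (.branch 2974020 34915608 21256578
  75771080 (.branch 9214352 5604648 35971334 84161700 (.forced 38030664 2927008 68448450 25499922
  (.forced 68457648 9275672 35925344 21256578 (.forced 19212578 34392344 68461736 12852672 (.forced
  10824002 34398476 18101664 71584968 (.forced 75795608 2910656 34918674 21316876 (.forced 68469912
  34384168 19220754 12852672 (.forced 9737616 67924164 35925344 21316876 (.leaf 144)))))))) (.leaf
  3) (.leaf 3) (.forced 68448450 2967888 38050082 25439624 (.forced 67946648 34886992 19148192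
  12944652 (.branch 67938472 9798936 19162500 38018400 (.leaf 3) (.leaf 3) (.leaf 3) (.leaf 3)))))
  (.leaf 3) (.branch 1913184 10847508 21317898 100951116 (.leaf 3) (.forced 9770320 17592708
  69479648 38050082 (.forced 12884354 17639720 68433120 35933520 (.forced 18171160 67948692 35956004
  12852672 (.forced 69494978 9247056 18101664 38064390 (.forced 34369860 5607714 69510308 25435536
  (.forced 21302568 67909856 9737616 35939652 (.forced 5576032 67918032 19162500 42241304 (.leaf
  130)))))))) (.leaf 3) (.forced 38064390 17578400 9770320 69493956 (.forced 9737616 67909856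
  35939652 21302568 (.branch 34398476 18101664 10824002 71584968 (.leaf 3) (.leaf 3) (.leaf 3)
  (.leaf 3))))) (.branch 2935184 34907432 12947718 84162722 (.leaf 3) (.forced 69493956 34363728
  5543328 25506054 (.forced 68461736 34355552 19156368 12945674 (.forced 42216776 67924164 3458448
  21304612 (.forced 35965202 17578400 68441296 12913992 (.forced 18101664 67918032 35964180 12913992
  (.forced 19162500 67946648 5604648 42212688 (.forced 34878816 67918032 19219732 12881288 (.leaf
  18)))))))) (.leaf 3) (.forced 1913184 10848530 21316876 100952138 (.forced 67948692 18171160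
  35956004 12852672 (.branch 67909856 9770320 19162500 38047016 (.leaf 3) (.leaf 3) (.leaf 3) (.leaf
  3))))))) (.forced 9277716 34894146 69519506 21241248 (.forced 42250502 17635632 5526976 69519506
  (.forced 19219732 67946648 34907432 12852672 (.forced 68464802 17639720 35965202 12852672 (.forced
  68445384 34392344 10824002 21241248 (.forced 38064390 9189824 18158896 69510308 (.branch 1880480
  10824002 71616650 50619660 (.forced 12913992 67918032 18101664 35964180 (.forced 34903344 67909856
  10822980 21253512 (.forced 71584968 17578400 34922762 10822980 (.forced 9214352 68433120 35940674
  21302568 (.forced 67922120 34915608 10822980 21241248 (.leaf 72)))))) (.leaf 3) (.leaf 3) (.forced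
  21319942 34355552 9737616 69493956 (.forced 68469912 34367816 10848530 21241248 (.forced 10790276
  34367816 18166050 71572704 (.forced 12916036 67918032 34915608 19148192 (.forced 21255556 67934384
  9798936 35925344 (.leaf 260))))))))))))) (.leaf 3)) (.branch 9189824 68477066 19220754 38047016
  (.leaf 3) (.leaf 3) (.forced 19156368 67909856 34907432 12916036 (.branch 1864128 35957026
  71603364 25502988 (.leaf 3) (.forced 10854662 34380080 5555592 84161700 (.forced 6589856 34367816
  68441296 25499922 (.forced 3491152 67922120 38047016 25441668 (.forced 69519506 17578400 34886992
  12947718 (.forced 2998548 34910498 12881288 84170898 (.forced 35925344 67918032 18171160 12883332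
  (.forced 10824002 34392344 68445384 21241248 (.forced 2984240 68464802 38033730 25439624 (.leaf
  9))))))))) (.forced 21304612 67934384 34915608 10759616 (.forced 35956004 9251144 18116994
  71572704 (.forced 100938852 17635632 5588296 10854662 (.forced 38033730 9218440 68433120 19205424
  (.forced 9806090 34355552 19162500 71601320 (.forced 67946648 34907432 19219732 12852672 (.forced
  17590664 68464802 10848530 38018400 (.forced 9798936 67948692 35939652 21241248 (.leaf 36)))))))))
  (.leaf 3))) (.forced 68469912 34384168 19220754 12852672 (.forced 34910498 2910656 71601320
  25502988 (.branch 67922120 34915608 10822980 21241248 (.leaf 3) (.leaf 3) (.leaf 3) (.leaf 3)))))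
  (.leaf 3)) (.branch 9281804 34878816 19163522 71601320 (.branch 2998548 9774408 21305634 100954182
  (.forced 10759616 34398476 18166050 71603364 (.forced 68441296 34355552 19220754 12881288 (.forced
  10848530 34355552 68457648 21253512 (.forced 9189824 68457648 35965202 21302568 (.branch 5065032
  18116994 35964180 75766992 (.leaf 3) (.leaf 3) (.forced 67938472 34915608 19211556 12852672
  (.branch 67918032 18171160 35925344 12883332 (.leaf 3) (.leaf 3) (.leaf 3) (.leaf 3))) (.forced
  67924164 9774408 35964180 21241248 (.forced 69479648 34369860 9737616 21305634 (.forced 12944652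
  67946648 34886992 19148192 (.forced 71584968 2927008 34894146 25502988 (.forced 50622726 9214352
  5576032 69510308 (.forced 67909856 34886992 19211556 12881288 (.leaf 192)))))))))))) (.leaf 3)
  (.forced 18166050 34398476 10759616 71603364 (.forced 69518484 34386212 18174226 12852672 (.forced
  38032708 17578400 9802002 69525638 (.forced 34891080 67909856 10784144 21304612 (.forced 35964180
  67918032 18101664 12913992 (.forced 68464802 17586576 35925344 12945674 (.forced 19156368 67938472
  34878816 12944652 (.forced 3491152 67946648 12883332 50605352 (.leaf 34))))))))) (.leaf 3))
  (.branch 67918032 18158896 6604164 42216776 (.leaf 3) (.forced 50620682 9220484 3482976 71601320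
  (.forced 34886992 67909856 19211556 12881288 (.forced 12945674 34355552 68461736 19156368 (.forced
  50607396 67948692 3491152 12881288 (.branch 17649940 3433920 38062346 75804806 (.leaf 3) (.forced
  68448450 9214352 35925344 21317898 (.forced 34380080 68469912 10759616 21317898 (.branch 34355552
  68441296 19220754 12881288 (.leaf 3) (.leaf 3) (.leaf 3) (.leaf 3)))) (.forced 68433120 17635632
  10791298 38030664 (.forced 25435536 34384168 68445384 6637890 (.forced 12916036 67909856 34907432
  19156368 (.forced 2959712 68461736 12884354 50613528 (.forced 68457648 34363728 6654242 25439624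
  (.forced 12852672 67938472 34915608 19211556 (.leaf 10))))))) (.leaf 3)))))) (.forced 10790276
  34355552 18178314 71584968 (.forced 84177030 9214352 5619978 35956004 (.forced 9275672 3465602
  38049060 84159656 (.forced 5065032 68477066 10784144 50608418 (.forced 21305634 2935184 68448450
  42216776 (.forced 67948692 9713088 35949872 21316876 (.forced 19220754 34384168 68469912 12852672
  (.forced 17639720 68433120 35933520 12884354 (.forced 34915608 67938472 19211556 12852672 (.leaf
  132)))))))))) (.leaf 3)) (.leaf 3) (.branch 2941316 18162984 71584968 42219842 (.leaf 3) (.forced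
  10791298 17641764 34891080 71572704 (.forced 34369860 9741704 19212578 71572704 (.forced 67938472
  34915608 19211556 12852672 (.forced 10848530 34367816 68469912 21241248 (.forced 18174226 34386212
  69518484 12852672 (.forced 67924164 9774408 35964180 21241248 (.branch 34398476 5591362 19156368
  75773124 (.leaf 3) (.forced 34886992 17578400 69519506 12947718 (.forced 67918032 34878816
  19219732 12881288 (.forced 17592708 5607714 69519506 42212688 (.forced 71618694 17578400 9806090
  35939652 (.forced 68461736 34392344 19212578 12852672 (.leaf 40)))))) (.leaf 3) (.forced 18166050
  34394388 69510308 12852672 (.forced 12881288 34363728 68433120 19212578 (.forced 35965202 17578400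
  68441296 12913992 (.forced 9214352 68433120 35940674 21302568 (.forced 34392344 68461736 19212578
  12852672 (.leaf 68))))))))))))) (.forced 71603364 9281804 18116994 35925344 (.branch 9247056
  5619978 19211556 100954182 (.branch 9220484 18174226 69494978 38018400 (.leaf 3) (.forced 17647896
  68472978 35957026 12852672 (.forced 34918674 17578400 69487824 12916036 (.forced 34380080 68433120
  10824002 21253512 (.forced 35964180 1864128 21317898 75798674 (.forced 18171160 67918032 35925344
  12883332 (.forced 9737616 67924164 35925344 21316876 (.forced 50601264 67938472 9774408 6604164
  (.leaf 272)))))))) (.leaf 3) (.forced 75804806 17649940 3433920 38062346 (.forced 12945674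
  17586576 68464802 35925344 (.branch 67924164 3491152 38049060 25439624 (.leaf 3) (.leaf 3) (.leaf
  3) (.leaf 3))))) (.branch 5067076 34922762 19156368 75774146 (.forced 12947718 34363728 18101664
  69518484 (.forced 5003712 34903344 69511330 25506054 (.forced 38050082 17647896 68477066 10759616
  (.forced 12881288 34363728 68433120 19212578 (.forced 21316876 67948692 9713088 35949872 (.forced
  6653220 9214352 34922762 84159656 (.forced 21241248 67922120 34915608 10822980 (.leaf 17))))))))
  (.leaf 3) (.leaf 3) (.forced 18171160 2910656 38064390 75801740 (.forced 69510308 34355552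
  18109840 12947718 (.branch 34398476 5526976 19220754 75795608 (.leaf 3) (.leaf 3) (.leaf 3) (.leaf
  3))))) (.leaf 3) (.branch 67924164 3450272 38030664 25498900 (.forced 69518484 34369860 9802002
  21241248 (.forced 75801740 34369860 5619978 19156368 (.forced 68433120 17639720 35933520 12884354
  (.forced 84155568 9277716 34907432 6605186 (.forced 67938472 34915608 19211556 12852672 (.forced
  68472978 9275672 35940674 21241248 (.forced 69519506 9277716 34894146 21241248 (.leaf 257))))))))
  (.leaf 3) (.forced 9214352 68448450 35925344 21317898 (.forced 38033730 9220484 18158896 69479648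
  (.forced 3458448 67924164 21304612 42216776 (.forced 1888656 69494978 21305634 42218820 (.forced
  38050082 17592708 9770320 69479648 (.branch 1864128 35965202 21316876 75797652 (.leaf 3) (.forced
  68469912 34384168 19220754 12852672 (.branch 34363728 18166050 69479648 12883332 (.leaf 3) (.leaf
  3) (.leaf 3) (.leaf 3))) (.leaf 3) (.forced 12852672 34392344 68461736 19212578 (.branch 34363728
  18101664 69518484 12947718 (.leaf 3) (.leaf 3) (.leaf 3) (.leaf 3))))))))) (.leaf 3)))) (.leaf
  3))) (.branch 5083428 18178314 10816848 100939874 (.leaf 3) (.branch 1892744 19212578 71588034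
  42218820 (.leaf 3) (.forced 67940516 18162984 35964180 12852672 (.forced 34922762 9189824 19211556
  71601320 (.forced 38064390 17578400 9770320 69493956 (.forced 10791298 17647896 68445384 38018400
  (.forced 35965202 9189824 68457648 21302568 (.forced 21305634 34392344 68457648 10759616 (.forced
  12947718 34355552 18109840 69510308 (.forced 5591362 34386212 69493956 25435536 (.leaf
  258))))))))) (.leaf 3) (.forced 42247436 67948692 18158896 6573504 (.forced 42248458 17635632
  68472978 6573504 (.branch 2935184 34891080 21319942 75774146 (.leaf 3) (.forced 10824002 34386212
  18113928 71572704 (.forced 12852672 67948692 18171160 35956004 (.branch 34380080 5526976 69510308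
  25506054 (.leaf 3) (.leaf 3) (.leaf 3) (.leaf 3)))) (.forced 71572704 34367816 18166050 10790276
  (.forced 67909856 34903344 10822980 21253512 (.forced 19220754 34355552 68441296 12881288 (.forced
  68461736 34392344 19212578 12852672 (.forced 69511330 5083428 34894146 25435536 (.forced 67940516
  18162984 35964180 12852672 (.forced 17578400 34886992 69519506 12947718 (.leaf 160)))))))) (.leaf
  3))))) (.branch 5065032 18158896 10854662 100939874 (.forced 34878816 67934384 10847508 21253512
  (.forced 38033730 9218440 68433120 19205424 (.forced 84173964 1949976 10791298 38049060 (.forced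
  34367816 3514658 71601320 25441668 (.forced 6573504 34384168 68457648 25499922 (.forced 12916036
  67909856 34907432 19156368 (.forced 34355552 68441296 19220754 12881288 (.forced 5588296 67918032
  35949872 25441668 (.leaf 320))))))))) (.leaf 3) (.forced 10847508 67934384 34878816 21253512
  (.forced 10824002 34392344 68445384 21241248 (.branch 34355552 9737616 69493956 21319942 (.leaf 3)
  (.forced 12852672 67938472 34915608 19211556 (.forced 25499922 34369860 5543328 69487824 (.forced
  12881288 34355552 68441296 19220754 (.forced 9275672 5543328 35971334 84170898 (.forced 25504010
  34380080 68461736 6573504 (.forced 75771080 34392344 3498306 21255556 (.leaf 33))))))) (.leaf 3)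
  (.forced 35939652 67909856 9737616 21302568 (.forced 35965202 9189824 68457648 21302568 (.forced
  1921360 69493956 38049060 25442690 (.forced 42243348 67946648 3433920 21302568 (.branch 5052768
  9806090 19219732 100954182 (.leaf 3) (.leaf 3) (.forced 34886992 67909856 19211556 12881288
  (.branch 34392344 68441296 19148192 12917058 (.leaf 3) (.leaf 3) (.leaf 3) (.leaf 3))) (.forced
  9218440 68448450 19220754 38018400 (.branch 9277716 34894146 69519506 21241248 (.leaf 3) (.leaf 3)
  (.leaf 3) (.leaf 3))))))))))) (.leaf 3)) (.branch 1921360 69493956 38049060 25442690 (.leaf 3)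
  (.leaf 3) (.forced 34907432 67909856 19156368 12916036 (.forced 35949872 67909856 9774408 21255556
  (.forced 34915608 67938472 19211556 12852672 (.forced 42241304 67952780 5526976 19211556 (.forced
  35964180 67940516 18162984 12852672 (.forced 42243348 67952780 18162984 6573504 (.branch 2910656
  18162984 71615628 42250502 (.leaf 3) (.leaf 3) (.forced 10790276 34367816 18166050 71572704
  (.forced 17647896 68445384 10791298 38018400 (.forced 6589856 34367816 68441296 25499922 (.forced
  12944652 67946648 34886992 19148192 (.forced 68469912 34384168 19220754 12852672 (.leaf 66))))))
  (.forced 35965202 17639720 68464802 12852672 (.forced 34355552 18174226 69487824 12883332 (.forced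
  100932720 17639720 9802002 6636868 (.forced 34394388 18166050 69510308 12852672 (.forced 34363728
  68433120 19212578 12881288 (.leaf 129))))))))))))) (.forced 84162722 5032328 34903344 10854662
  (.branch 17641764 5588296 10848530 100932720 (.branch 67940516 18162984 35964180 12852672 (.forced
  34894146 5083428 69511330 25435536 (.forced 34369860 5555592 19220754 75766992 (.forced 6605186
  1925448 75801740 50615572 (.forced 68433120 17639720 35933520 12884354 (.forced 25496856 5020064
  68441296 35940674 (.forced 6589856 67918032 34891080 25498900 (.forced 42250502 17586576 5576032
  69493956 (.leaf 24)))))))) (.leaf 3) (.forced 25435536 67924164 5588296 35956004 (.forced 12917058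
  34386212 18109840 69479648 (.branch 34394388 18113928 6637890 75766992 (.leaf 3) (.leaf 3) (.leaf
  3) (.leaf 3)))) (.leaf 3)) (.branch 1921360 19163522 38061324 75773124 (.leaf 3) (.forced 35957026
  17586576 68433120 12913992 (.forced 34384168 68469912 19220754 12852672 (.forced 67948692 3433920
  21304612 42241304 (.forced 25439624 67918032 34903344 6636868 (.forced 17649940 34910498 69519506
  12852672 (.forced 69494978 9253188 34918674 21241248 (.forced 75771080 34363728 18178314 6604164
  (.leaf 20)))))))) (.forced 68433120 17635632 10791298 38030664 (.forced 34394388 18101664 69487824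
  12917058 (.branch 34367816 68461736 6654242 25435536 (.leaf 3) (.leaf 3) (.leaf 3) (.leaf 3))))
  (.leaf 3)) (.leaf 3) (.branch 17649940 3433920 38062346 75804806 (.leaf 3) (.forced 50616594
  2941316 5588296 75795608 (.forced 71572704 34386212 18113928 10824002 (.forced 5020064 68441296
  35940674 25496856 (.forced 9247056 5543328 69519506 50622726 (.forced 38050082 17590664 68433120
  10816848 (.forced 17654028 9713088 35957026 71618694 (.forced 3458448 34369860 21317898 75771080
  (.leaf 12)))))))) (.leaf 3) (.forced 42243348 5003712 18166050 69525638 (.forced 34878816 67918032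
  19219732 12881288 (.branch 67934384 9741704 6622560 50615572 (.leaf 3) (.leaf 3) (.leaf 3) (.leaf
  3))))))))))

/-- The search starts from all 280 codes, without reduction by symmetry. In a `branch`, the subtree
of a member that is already excluded is irrelevant, so any tree may stand there; a `branch` with all
four members excluded closes a contradictory case. -/
theorem check_cliqueSearch : cliqueSearch.check partitionCodes = true := by decide +kernel

/-! ### Masks as subsets -/

theorem mem_maskSet {m : ℕ} {i : Fin 9} : i ∈ maskSet m ↔ m.testBit i = true := by
  simp [maskSet]

theorem maskSet_injOn {x y : ℕ} (hx : x < 512) (hy : y < 512) (h : maskSet x = maskSet y) :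
    x = y := by
  apply Nat.eq_of_testBit_eq
  intro i
  by_cases hi : i < 9
  · have := congrArg (fun s => (⟨i, hi⟩ : Fin 9) ∈ s) h
    simp only [mem_maskSet, eq_iff_iff] at this
    exact Bool.eq_iff_iff.mpr this
  · have h9 : 2 ^ 9 ≤ 2 ^ i := Nat.pow_le_pow_right (by norm_num) (not_lt.mp hi)
    rw [Nat.testBit_lt_two_pow (by omega), Nat.testBit_lt_two_pow (by omega)]

theorem exists_maskSet_eq (s : Finset (Fin 9)) : ∃ m < 512, maskSet m = s := by
  refine ⟨Nat.ofBits fun i : Fin 9 => decide (i ∈ s), Nat.ofBits_lt_two_pow _, ?_⟩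
  ext i
  simp [mem_maskSet, Nat.testBit_ofBits_lt]

theorem maskSet_land (x y : ℕ) : maskSet (Nat.land x y) = maskSet x ∩ maskSet y := by
  ext i
  change i ∈ maskSet (x &&& y) ↔ _
  simp [mem_maskSet]

theorem masksMeet_iff {x y : ℕ} (hx : x < 512) :
    masksMeet x y = true ↔ (maskSet x ∩ maskSet y).Nonempty := by
  rw [← maskSet_land, Finset.nonempty_iff_ne_empty]
  have h0 : maskSet 0 = ∅ := by ext i; simp [mem_maskSet]
  have hlt : Nat.land x y < 512 := lt_of_le_of_lt Nat.and_le_left hx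
  rw [masksMeet, Bool.not_eq_true', ← Bool.not_eq_true, Nat.beq_eq]
  refine not_congr ⟨fun h => by rw [h, h0], fun h => ?_⟩
  exact maskSet_injOn hlt (by norm_num) (h.trans h0.symm)

theorem mem_tripleMasks {m : ℕ} : m ∈ tripleMasks ↔ m < 512 ∧ (maskSet m).card = 3 := by
  simp [tripleMasks]

theorem mem_pairMasks {m : ℕ} : m ∈ pairMasks ↔ m < 512 ∧ (maskSet m).card = 2 := by
  simp [pairMasks]

theorem cellA_packCode {x y z : ℕ} (hy : y < 512) (hz : z < 512) :
    cellA (packCode x y z) = x := by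
  -- The cells are the digits in base 512, and 262144 is the square of 512.
  change (x * 262144 + y * 512 + z) / 262144 = x
  omega

theorem cellB_packCode {x y z : ℕ} (hy : y < 512) (hz : z < 512) :
    cellB (packCode x y z) = y := by
  change (x * 262144 + y * 512 + z) / 512 % 512 = y
  omega

theorem cellC_packCode {x y z : ℕ} (hz : z < 512) : cellC (packCode x y z) = z := by
  change (x * 262144 + y * 512 + z) % 512 = z
  omega

theorem mem_partitionCodes {q : ℕ} : q ∈ partitionCodes ↔
    ∃ x ∈ tripleMasks, ∃ y ∈ tripleMasks, ∃ z ∈ tripleMasks, (0 : Fin 9) ∈ maskSet x ∧ y < z ∧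
      Disjoint (maskSet x) (maskSet y) ∧ Disjoint (maskSet x) (maskSet z) ∧
      Disjoint (maskSet y) (maskSet z) ∧ packCode x y z = q := by
  have h1 : maskSet 1 = {0} := by decide
  have hdis {x y : ℕ} (hx : x ∈ tripleMasks) :
      masksMeet x y = false ↔ Disjoint (maskSet x) (maskSet y) := by
    rw [← Bool.not_eq_true, masksMeet_iff (mem_tripleMasks.mp hx).1,
      Finset.not_nonempty_iff_eq_empty, Finset.disjoint_iff_inter_eq_empty]
  have hodd {x : ℕ} (hx : x ∈ tripleMasks) : masksMeet x 1 = true ↔ (0 : Fin 9) ∈ maskSet x := by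
    rw [masksMeet_iff (mem_tripleMasks.mp hx).1, h1]
    simp [Finset.inter_singleton]
    by_cases h : (0 : Fin 9) ∈ maskSet x <;> simp [h]
  simp only [partitionCodes, List.mem_flatMap, List.mem_filter, List.mem_map, Bool.and_eq_true,
    Bool.not_eq_true', Nat.blt_eq]
  constructor
  · rintro ⟨x, ⟨hx, hx1⟩, y, ⟨hy, hxy⟩, z, ⟨hz, hyz, hxz, hyz'⟩, rfl⟩
    exact ⟨x, hx, y, hy, z, hz, (hodd hx).mp hx1, hyz, (hdis hx).mp hxy, (hdis hx).mp hxz,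
      (hdis hy).mp hyz', rfl⟩
  · rintro ⟨x, hx, y, hy, z, hz, h0, hyz, hxy, hxz, hyz', rfl⟩
    exact ⟨x, ⟨hx, (hodd hx).mpr h0⟩, y, ⟨hy, (hdis hx).mpr hxy⟩, z,
      ⟨hz, hyz, (hdis hx).mpr hxz, (hdis hy).mpr hyz'⟩, rfl⟩

/-! ### Codes correspond to partitions -/

/-- The code `q` describes the partition `P`. -/
def Encodes (q : ℕ) (P : TriplePartition) : Prop :=
  P.1.parts = {maskSet (cellA q), maskSet (cellB q), maskSet (cellC q)}

theorem encodes_packCode {x y z : ℕ} (hy : y < 512) (hz : z < 512) {P : TriplePartition} :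
    Encodes (packCode x y z) P ↔ P.1.parts = {maskSet x, maskSet y, maskSet z} := by
  rw [Encodes, cellA_packCode hy hz, cellB_packCode hy hz, cellC_packCode hz]

theorem exists_encodes {q : ℕ} (hq : q ∈ partitionCodes) : ∃ P, Encodes q P := by
  obtain ⟨x, hx, y, hy, z, hz, h0, hyz, dxy, dxz, dyz, rfl⟩ := mem_partitionCodes.mp hq
  rw [mem_tripleMasks] at hx hy hz
  have hne {s t : Finset (Fin 9)} (hs : s.card = 3) (d : Disjoint s t) : s ≠ t := by
    rintro rfl
    simp at d
    simp [d] at hs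
  have cxy := hne hx.2 dxy
  have cxz := hne hx.2 dxz
  have cyz := hne hy.2 dyz
  let P : Finpartition (Finset.univ : Finset (Fin 9)) :=
    { parts := {maskSet x, maskSet y, maskSet z}
      supIndep := by
        rw [Finset.supIndep_iff_pairwiseDisjoint]
        intro a ha b hb hab
        simp only [Finset.coe_insert, Finset.coe_singleton, Set.mem_insert_iff,
          Set.mem_singleton_iff] at ha hb
        rcases ha with rfl | rfl | rfl <;> rcases hb with rfl | rfl | rfl <;>
          first
          | exact absurd rfl hab
          | assumption
          | exact Disjoint.symm (by assumption)
      sup_parts := by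
        simp only [Finset.sup_insert, Finset.sup_singleton, id_eq, Finset.sup_eq_union]
        -- Three disjoint triples contain nine points, hence all of them.
        apply Finset.eq_univ_of_card
        rw [Finset.card_union_of_disjoint, Finset.card_union_of_disjoint dyz, hx.2, hy.2, hz.2]
        · rfl
        · exact Finset.disjoint_union_right.mpr ⟨dxy, dxz⟩
      bot_notMem := by
        simp only [Finset.bot_eq_empty, Finset.mem_insert, Finset.mem_singleton, not_or]
        refine ⟨?_, ?_, ?_⟩ <;> intro h
        · simp [← h] at hx
        · simp [← h] at hy
        · simp [← h] at hz }
  refine ⟨⟨P, ?_, ?_⟩, ?_⟩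
  · exact Finset.card_eq_three.mpr ⟨_, _, _, cxy, cxz, cyz, rfl⟩
  · intro c hc
    simp only [P, Finset.mem_insert, Finset.mem_singleton] at hc
    rcases hc with rfl | rfl | rfl
    exacts [hx.2, hy.2, hz.2]
  · rw [encodes_packCode hy.1 hz.1]

theorem exists_code (P : TriplePartition) : ∃ q ∈ partitionCodes, Encodes q P := by
  obtain ⟨c, hc, h0⟩ := P.1.exists_mem (Finset.mem_univ (0 : Fin 9))
  have h2 : (P.1.parts.erase c).card = 2 := by
    rw [Finset.card_erase_of_mem hc, P.2.1]
  obtain ⟨a, b, hab, h⟩ := Finset.card_eq_two.mp h2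
  have hparts : P.1.parts = {c, a, b} := by rw [← h, Finset.insert_erase hc]
  have ha : a ∈ P.1.parts.erase c := by simp [h]
  have hb : b ∈ P.1.parts.erase c := by simp [h]
  rw [Finset.mem_erase] at ha hb
  have hca := P.1.disjoint hc ha.2 ha.1.symm
  have hcb := P.1.disjoint hc hb.2 hb.1.symm
  have hab' := P.1.disjoint ha.2 hb.2 hab
  obtain ⟨x, hx, rfl⟩ := exists_maskSet_eq c
  obtain ⟨y, hy, rfl⟩ := exists_maskSet_eq a
  obtain ⟨z, hz, rfl⟩ := exists_maskSet_eq b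
  have tx := mem_tripleMasks.mpr ⟨hx, P.2.2 _ hc⟩
  have ty := mem_tripleMasks.mpr ⟨hy, P.2.2 _ ha.2⟩
  have tz := mem_tripleMasks.mpr ⟨hz, P.2.2 _ hb.2⟩
  rcases lt_trichotomy y z with hyz | rfl | hyz
  · exact ⟨_, mem_partitionCodes.mpr ⟨x, tx, y, ty, z, tz, h0, hyz, hca, hcb, hab', rfl⟩,
      (encodes_packCode hy hz).mpr hparts⟩
  · exact absurd rfl hab
  · refine ⟨_, mem_partitionCodes.mpr ⟨x, tx, z, tz, y, ty, h0, hyz, hcb, hca, hab'.symm, rfl⟩,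
      (encodes_packCode hz hy).mpr ?_⟩
    rw [hparts, Finset.pair_comm]

theorem Encodes.eq_partition {q : ℕ} {P Q : TriplePartition} (hP : Encodes q P)
    (hQ : Encodes q Q) : P = Q :=
  Subtype.ext (Finpartition.ext (hP.trans hQ.symm))

/-- The code is a normal form: the cell of `0` comes first, and the other two cells are sorted by
mask. -/
theorem Encodes.eq_code {q r : ℕ} {P : TriplePartition} (hq : q ∈ partitionCodes)
    (hr : r ∈ partitionCodes) (hqP : Encodes q P) (hrP : Encodes r P) : q = r := by
  obtain ⟨x, hx, y, hy, z, hz, h0, hyz, dxy, dxz, dyz, rfl⟩ := mem_partitionCodes.mp hq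
  obtain ⟨x', hx', y', hy', z', hz', h0', hyz', dxy', dxz', dyz', rfl⟩ := mem_partitionCodes.mp hr
  rw [mem_tripleMasks] at hx hy hz hx' hy' hz'
  rw [encodes_packCode hy.1 hz.1] at hqP
  rw [encodes_packCode hy'.1 hz'.1] at hrP
  have key : ({maskSet x, maskSet y, maskSet z} : Finset (Finset (Fin 9))) =
      {maskSet x', maskSet y', maskSet z'} := hqP.symm.trans hrP
  have hxx : x = x' := by
    apply maskSet_injOn hx.1 hx'.1
    have hm : maskSet x ∈ ({maskSet x', maskSet y', maskSet z'} : Finset (Finset (Fin 9))) := by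
      rw [← key]; simp
    simp only [Finset.mem_insert, Finset.mem_singleton] at hm
    rcases hm with h | h | h
    · exact h
    · exact absurd (h ▸ h0) (Finset.disjoint_left.mp dxy' h0')
    · exact absurd (h ▸ h0) (Finset.disjoint_left.mp dxz' h0')
  subst hxx
  have hmem {u v w : ℕ} (hu : u < 512) (hv : v < 512) (hw : w < 512)
      (dxu : Disjoint (maskSet x) (maskSet u))
      (h : maskSet u ∈ ({maskSet x, maskSet v, maskSet w} : Finset (Finset (Fin 9))))
      (hc : (maskSet u).card = 3) : u = v ∨ u = w := by
    simp only [Finset.mem_insert, Finset.mem_singleton] at h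
    rcases h with h | h | h
    · rw [h] at dxu
      simp at dxu
      rw [h, dxu] at hc
      simp at hc
    · exact .inl (maskSet_injOn hu hv h)
    · exact .inr (maskSet_injOn hu hw h)
  have h1 := hmem hy.1 hy'.1 hz'.1 dxy (by rw [← key]; simp) hy.2
  have h2 := hmem hz.1 hy'.1 hz'.1 dxz (by rw [← key]; simp) hz.2
  have h3 := hmem hy'.1 hy.1 hz.1 dxy' (by rw [key]; simp) hy'.2
  -- The orders `y < z` and `y' < z'` rule out that the two cells are swapped.
  obtain ⟨rfl, rfl⟩ : y = y' ∧ z = z' := by omega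
  rfl

theorem card_triplePartition : Nat.card TriplePartition = 280 := by
  choose e he using fun P => exists_code P
  have hbij : Function.Bijective fun P => (⟨e P, (he P).1⟩ : {q // q ∈ partitionCodes}) := by
    refine ⟨fun P Q h => ?_, fun ⟨q, hq⟩ => ?_⟩
    · have h' : e P = e Q := congrArg Subtype.val h
      exact (he P).2.eq_partition (h' ▸ (he Q).2)
    · obtain ⟨P, hP⟩ := exists_encodes hq
      exact ⟨P, Subtype.ext (Encodes.eq_code (he P).1 hq (he P).2 hP)⟩
  rw [Nat.card_eq_of_bijective _ hbij]
  have := List.toFinset_card_of_nodup nodup_partitionCodes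
  rw [length_partitionCodes] at this
  rw [← this, ← Nat.card_eq_finsetCard]
  exact Nat.card_congr (Equiv.subtypeEquivRight fun q => List.mem_toFinset.symm)

/-! ### Skewness and covered pairs, read off from codes -/

/-- A cell of the partition `P` contains the set `e`. -/
def TriplePartition.Covers (P : TriplePartition) (e : Finset (Fin 9)) : Prop :=
  ∃ c ∈ P.1.parts, e ⊆ c

/-- The three points of `a` are distributed over the three cells of `Q`; if each cell receives at
least one, each receives exactly one. This is why `codesSkew` only tests whether cells meet. -/
theorem skew_of_inter_nonempty {P Q : TriplePartition}
    (h : ∀ a ∈ P.1.parts, ∀ b ∈ Q.1.parts, (a ∩ b).Nonempty) : P.Skew Q := by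
  intro a ha b hb
  -- Double counting: every point lies in exactly one cell of `Q`.
  have hsum : ∑ t ∈ Q.1.parts, (a ∩ t).card = a.card * 1 := by
    apply Finset.sum_card_inter
    intro i _
    rw [Finset.card_eq_one]
    refine ⟨Q.1.part i, ?_⟩
    ext t
    simp only [Finset.mem_filter, Finset.mem_singleton]
    constructor
    · rintro ⟨ht, hi⟩
      exact (Q.1.part_eq_of_mem ht hi).symm
    · rintro rfl
      exact ⟨Q.1.part_mem.mpr (Finset.mem_univ i), Q.1.mem_part (Finset.mem_univ i)⟩
  have hle : ∀ t ∈ Q.1.parts, 1 ≤ (a ∩ t).card := fun t ht => Finset.card_pos.mpr (h a ha t ht)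
  have heq : ∑ t ∈ Q.1.parts, 1 = ∑ t ∈ Q.1.parts, (a ∩ t).card := by
    rw [hsum, P.2.2 a ha]
    simp [Q.2.1]
  exact ((Finset.sum_eq_sum_iff_of_le hle).mp heq b hb).symm

theorem cellA_lt {q : ℕ} (hq : q ∈ partitionCodes) : cellA q < 512 := by
  obtain ⟨x, hx, y, hy, z, hz, -, -, -, -, -, rfl⟩ := mem_partitionCodes.mp hq
  rw [mem_tripleMasks] at hx hy hz
  rw [cellA_packCode hy.1 hz.1]
  exact hx.1

theorem cellB_lt (q : ℕ) : cellB q < 512 := Nat.mod_lt _ (by norm_num)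

theorem cellC_lt (q : ℕ) : cellC q < 512 := Nat.mod_lt _ (by norm_num)

theorem Encodes.skew {p q : ℕ} {P Q : TriplePartition} (hp : p ∈ partitionCodes)
    (hP : Encodes p P) (hQ : Encodes q Q) (h : codesSkew p q = true) : P.Skew Q := by
  simp only [codesSkew, Bool.and_eq_true, masksMeet_iff (cellA_lt hp), masksMeet_iff (cellB_lt p),
    masksMeet_iff (cellC_lt p)] at h
  refine skew_of_inter_nonempty ?_
  rw [hP, hQ]
  simp only [Finset.mem_insert, Finset.mem_singleton, forall_eq_or_imp, forall_eq]
  obtain ⟨hAA, hBB, hAB, hBA, hCC, hAC, hCA, hBC, hCB⟩ := h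
  exact ⟨⟨hAA, hAB, hAC⟩, ⟨hBA, hBB, hBC⟩, hCA, hCB, hCC⟩

theorem Encodes.covers {m q : ℕ} {P : TriplePartition} (hP : Encodes q P)
    (h : codeCovers m q = true) : P.Covers (maskSet m) := by
  have key {x : ℕ} (hx : Nat.beq (Nat.land x m) m = true) : maskSet m ⊆ maskSet x := by
    rw [Nat.beq_eq] at hx
    rw [← hx, maskSet_land]
    exact Finset.inter_subset_left
  unfold TriplePartition.Covers
  rw [hP]
  simp only [codeCovers, Bool.or_eq_true] at h
  rcases h with h | h | h
  · exact ⟨_, by simp, key h⟩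
  · exact ⟨_, by simp, key h⟩
  · exact ⟨_, by simp, key h⟩

theorem natMem_iff {q : ℕ} {L : List ℕ} : natMem q L = true ↔ q ∈ L := by
  simp [natMem]

/-! ### Sets with one member in each clique of size four -/

/-- The set of partitions contains exactly one member of each clique of size four. -/
structure MeetsCliques (T : TriplePartition → Prop) : Prop where
  indep : ∀ P Q, T P → T Q → ¬ P.Skew Q
  exists_mem : ∀ P Q R S : TriplePartition, P.Skew Q → P.Skew R → P.Skew S → Q.Skew R →
    Q.Skew S → R.Skew S → T P ∨ T Q ∨ T R ∨ T S

/-- The list `L` contains the codes of all members of `T`. -/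
def CodesInclude (T : TriplePartition → Prop) (L : List ℕ) : Prop :=
  ∀ q ∈ partitionCodes, ∀ P, Encodes q P → T P → q ∈ L

/-- Since `T` is independent, nothing skew to a member of `T` belongs to `T`. -/
theorem CodesInclude.dropSkew {T : TriplePartition → Prop} (hT : MeetsCliques T) {L : List ℕ}
    (hL : CodesInclude T L) {a : ℕ} (ha : a ∈ partitionCodes) {A : TriplePartition}
    (hA : Encodes a A) (hTA : T A) : CodesInclude T (dropSkew a L) := by
  intro q hq P hqP hP
  refine List.mem_filter.mpr ⟨hL q hq P hqP hP, ?_⟩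
  rw [Bool.not_eq_true', ← Bool.not_eq_true]
  exact fun h => hT.indep A P hTA hP (hA.skew ha hqP h)

theorem MeetsCliques.exists_code {T : TriplePartition → Prop} (hT : MeetsCliques T)
    {a b c d : ℕ} (h : codesClique a b c d = true) {L : List ℕ} (hL : CodesInclude T L) :
    (a ∈ L ∧ CodesInclude T (dropSkew a L)) ∨ (b ∈ L ∧ CodesInclude T (dropSkew b L)) ∨
      (c ∈ L ∧ CodesInclude T (dropSkew c L)) ∨ (d ∈ L ∧ CodesInclude T (dropSkew d L)) := by
  simp only [codesClique, Bool.and_eq_true, natMem_iff] at h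
  obtain ⟨⟨ha, hb, hc, hd⟩, hab, hac, had, hbc, hbd, hcd⟩ := h
  obtain ⟨A, hA⟩ := exists_encodes ha
  obtain ⟨B, hB⟩ := exists_encodes hb
  obtain ⟨C, hC⟩ := exists_encodes hc
  obtain ⟨D, hD⟩ := exists_encodes hd
  rcases hT.exists_mem A B C D (hA.skew ha hB hab) (hA.skew ha hC hac) (hA.skew ha hD had)
    (hB.skew hb hC hbc) (hB.skew hb hD hbd) (hC.skew hc hD hcd) with h | h | h | h
  · exact .inl ⟨hL a ha A hA h, hL.dropSkew hT ha hA h⟩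
  · exact .inr (.inl ⟨hL b hb B hB h, hL.dropSkew hT hb hB h⟩)
  · exact .inr (.inr (.inl ⟨hL c hc C hC h, hL.dropSkew hT hc hC h⟩))
  · exact .inr (.inr (.inr ⟨hL d hd D hD h, hL.dropSkew hT hd hD h⟩))

/-- Soundness of the checker. The invariant is that `L` contains the codes of all members of `T`, so
a member of a clique whose code is missing from `L` cannot be the one in `T`. Only an inclusion of
`T` in the set of a pair results here. -/
theorem CliqueSearch.exists_covers {T : TriplePartition → Prop} (hT : MeetsCliques T)
    (t : CliqueSearch) : ∀ L : List ℕ, t.check L = true → CodesInclude T L →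
      ∃ e : Finset (Fin 9), e.card = 2 ∧ ∀ P, T P → P.Covers e := by
  induction t with
  | leaf m =>
    intro L h hL
    simp only [check, Bool.and_eq_true, decide_eq_true_eq, List.all_eq_true] at h
    refine ⟨maskSet m, h.1, fun P hP => ?_⟩
    obtain ⟨q, hq, hqP⟩ := _root_.exists_code P
    exact hqP.covers (h.2 q (hL q hq P hqP hP))
  | forced a b c d t ih =>
    intro L h hL
    simp only [check, Bool.and_eq_true, Bool.not_eq_true', ← Bool.not_eq_true, natMem_iff] at h
    obtain ⟨hcl, hb, hc, hd, ht⟩ := h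
    rcases hT.exists_code hcl hL with h | h | h | h
    · exact ih _ ht h.2
    · exact absurd h.1 hb
    · exact absurd h.1 hc
    · exact absurd h.1 hd
  | branch a b c d ta tb tc td iha ihb ihc ihd =>
    intro L h hL
    simp only [check, Bool.and_eq_true, Bool.or_eq_true, Bool.not_eq_true', ← Bool.not_eq_true,
      natMem_iff] at h
    obtain ⟨hcl, ha, hb, hc, hd⟩ := h
    rcases hT.exists_code hcl hL with h | h | h | h
    · exact iha _ (ha.resolve_left (not_not_intro h.1)) h.2
    · exact ihb _ (hb.resolve_left (not_not_intro h.1)) h.2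
    · exact ihc _ (hc.resolve_left (not_not_intro h.1)) h.2
    · exact ihd _ (hd.resolve_left (not_not_intro h.1)) h.2

theorem not_skew_of_covers {P Q : TriplePartition} {e : Finset (Fin 9)} (he : e.card = 2)
    (hP : P.Covers e) (hQ : Q.Covers e) : ¬ P.Skew Q := by
  intro h
  obtain ⟨a, ha, hea⟩ := hP
  obtain ⟨b, hb, heb⟩ := hQ
  have h1 := Finset.card_le_card (Finset.subset_inter hea heb)
  rw [h a ha b hb, he] at h1
  norm_num at h1

/-- Needed to improve the inclusion obtained from the search to an equality. -/
theorem exists_clique (P : TriplePartition) : ∃ Q R S : TriplePartition,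
    P.Skew Q ∧ P.Skew R ∧ P.Skew S ∧ Q.Skew R ∧ Q.Skew S ∧ R.Skew S := by
  obtain ⟨a, ha, hP⟩ := exists_code P
  have h := exists_codes_clique
  simp only [List.all_eq_true, List.any_eq_true, List.mem_filter] at h
  obtain ⟨b, ⟨hb, hab⟩, c, ⟨⟨hc, hac⟩, hbc⟩, d, ⟨⟨hd, had⟩, hbd⟩, hcd⟩ := h a ha
  obtain ⟨Q, hQ⟩ := exists_encodes hb
  obtain ⟨R, hR⟩ := exists_encodes hc
  obtain ⟨S, hS⟩ := exists_encodes hd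
  exact ⟨Q, R, S, hP.skew ha hQ hab, hP.skew ha hR hac, hP.skew ha hS had, hQ.skew hb hR hbc,
    hQ.skew hb hS hbd, hR.skew hc hS hcd⟩

/-- The sets of partitions with exactly one member in each clique of size four are those
of the partitions with a cell containing a given pair. -/
theorem MeetsCliques.exists_iff_covers {T : TriplePartition → Prop} (hT : MeetsCliques T) :
    ∃ e : Finset (Fin 9), e.card = 2 ∧ ∀ P, T P ↔ P.Covers e := by
  obtain ⟨e, he, h⟩ := cliqueSearch.exists_covers hT _ check_cliqueSearch fun q hq _ _ _ => hq
  refine ⟨e, he, fun P => ⟨h P, fun hP => ?_⟩⟩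
  -- Some member of a clique through `P` lies in `T` and so covers `e`. It must be `P`, as the
  -- others are skew to `P`, which covers `e` too.
  obtain ⟨Q, R, S, hQ, hR, hS, hQR, hQS, hRS⟩ := exists_clique P
  rcases hT.exists_mem P Q R S hQ hR hS hQR hQS hRS with h' | h' | h' | h'
  · exact h'
  · exact absurd hQ (not_skew_of_covers he hP (h Q h'))
  · exact absurd hR (not_skew_of_covers he hP (h R h'))
  · exact absurd hS (not_skew_of_covers he hP (h S h'))

theorem exists_covers_pair_pair {e e' : Finset (Fin 9)} (he : e.card = 2) (he' : e'.card = 2) :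
    ∃ P : TriplePartition, P.Covers e ∧ P.Covers e' := by
  obtain ⟨m, hm, rfl⟩ := exists_maskSet_eq e
  obtain ⟨n, hn, rfl⟩ := exists_maskSet_eq e'
  have h := exists_code_covers_pairs
  simp only [List.all_eq_true, List.any_eq_true, List.mem_filter] at h
  obtain ⟨q, ⟨hq, hqm⟩, hqn⟩ := h m (mem_pairMasks.mpr ⟨hm, he⟩) n (mem_pairMasks.mpr ⟨hn, he'⟩)
  obtain ⟨P, hP⟩ := exists_encodes hq
  exact ⟨P, hP.covers hqm, hP.covers hqn⟩

/-- The partitions with a cell containing a given pair meet each clique of size four once. -/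
theorem meetsCliques_covers {e : Finset (Fin 9)} (he : e.card = 2) :
    MeetsCliques fun P => P.Covers e := by
  refine ⟨fun P Q => not_skew_of_covers he, fun P Q R S hPQ hPR hPS hQR hQS hRS => ?_⟩
  obtain ⟨x, y, hxy, rfl⟩ := Finset.card_eq_two.mp he
  -- `N P` consists of the two companions of `x` in its cell of `P`. Skew partitions have disjoint
  -- companions, so the four sets `N` exhaust the eight points other than `x`, and one of them
  -- contains `y`.
  let N : TriplePartition → Finset (Fin 9) := fun P => (P.1.part x).erase x
  have hmem (P : TriplePartition) : P.1.part x ∈ P.1.parts := P.1.part_mem.mpr (Finset.mem_univ x)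
  have hx (P : TriplePartition) : x ∈ P.1.part x := P.1.mem_part (Finset.mem_univ x)
  have hN (P : TriplePartition) : (N P).card = 2 := by
    rw [Finset.card_erase_of_mem (hx P), P.2.2 _ (hmem P)]
  have hd {P Q : TriplePartition} (h : P.Skew Q) : Disjoint (N P) (N Q) := by
    rw [Finset.disjoint_left]
    intro z hz hz'
    rw [Finset.mem_erase] at hz hz'
    obtain ⟨w, hw⟩ := Finset.card_eq_one.mp (h _ (hmem P) _ (hmem Q))
    have h1 : x ∈ P.1.part x ∩ Q.1.part x := Finset.mem_inter.mpr ⟨hx P, hx Q⟩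
    have h2 : z ∈ P.1.part x ∩ Q.1.part x := Finset.mem_inter.mpr ⟨hz.2, hz'.2⟩
    rw [hw, Finset.mem_singleton] at h1 h2
    exact hz.1 (h2.trans h1.symm)
  have hcov {P : TriplePartition} (h : y ∈ N P) : P.Covers {x, y} := by
    refine ⟨_, hmem P, ?_⟩
    rw [Finset.insert_subset_iff, Finset.singleton_subset_iff]
    exact ⟨hx P, Finset.mem_of_mem_erase h⟩
  have hcard : (N P ∪ (N Q ∪ (N R ∪ N S))).card = 8 := by
    rw [Finset.card_union_of_disjoint, Finset.card_union_of_disjoint,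
      Finset.card_union_of_disjoint (hd hRS)]
    · simp only [hN]
    · exact Finset.disjoint_union_right.mpr ⟨hd hQR, hd hQS⟩
    · exact Finset.disjoint_union_right.mpr
        ⟨hd hPQ, Finset.disjoint_union_right.mpr ⟨hd hPR, hd hPS⟩⟩
  have hsub : N P ∪ (N Q ∪ (N R ∪ N S)) ⊆ Finset.univ.erase x := by
    intro z hz
    have hne {P : TriplePartition} (h : z ∈ N P) : z ≠ x := Finset.ne_of_mem_erase h
    simp only [Finset.mem_union] at hz
    refine Finset.mem_erase.mpr ⟨?_, Finset.mem_univ z⟩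
    rcases hz with h | h | h | h <;> exact hne h
  have heq := Finset.eq_of_subset_of_card_le hsub (by rw [hcard]; simp)
  have hy : y ∈ N P ∪ (N Q ∪ (N R ∪ N S)) := by
    rw [heq]
    exact Finset.mem_erase.mpr ⟨hxy.symm, Finset.mem_univ y⟩
  simp only [Finset.mem_union] at hy
  rcases hy with h | h | h | h
  · exact .inl (hcov h)
  · exact .inr (.inl (hcov h))
  · exact .inr (.inr (.inl (hcov h)))
  · exact .inr (.inr (.inr (hcov h)))

/-! ### Endomorphisms act on pairs -/

theorem MeetsCliques.comp {T : TriplePartition → Prop} (hT : MeetsCliques T)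
    (f : skewGraph →g skewGraph) : MeetsCliques fun P => T (f P) := by
  have hf {P Q : TriplePartition} (h : P.Skew Q) : (f P).Skew (f Q) :=
    f.map_adj (show skewGraph.Adj P Q from h)
  exact ⟨fun P Q hP hQ h => hT.indep (f P) (f Q) hP hQ (hf h),
    fun P Q R S hPQ hPR hPS hQR hQS hRS => hT.exists_mem (f P) (f Q) (f R) (f S)
      (hf hPQ) (hf hPR) (hf hPS) (hf hQR) (hf hQS) (hf hRS)⟩

/-- For distinct pairs there is a third one such that no partition covers all three. -/
theorem exists_pair_not_covers {e e' : Finset (Fin 9)} (he : e.card = 2) (he' : e'.card = 2)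
    (hne : e ≠ e') : ∃ d : Finset (Fin 9), d.card = 2 ∧
      ∀ P : TriplePartition, P.Covers e → P.Covers e' → ¬ P.Covers d := by
  have hcell {P : TriplePartition} {a b : Finset (Fin 9)} {i : Fin 9} (ha : a ∈ P.1.parts)
      (hb : b ∈ P.1.parts) (hia : i ∈ a) (hib : i ∈ b) : a = b :=
    P.1.eq_of_mem_parts ha hb hia hib
  -- For disjoint pairs, let `d` join a point of `e` to one of `e'`: covering all three would force
  -- the four points of `e ∪ e'` into one cell.
  by_cases hdis : Disjoint e e'
  · obtain ⟨i, hi⟩ := Finset.card_pos.mp (he ▸ Nat.zero_lt_two)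
    obtain ⟨j, hj⟩ := Finset.card_pos.mp (he' ▸ Nat.zero_lt_two)
    have hij : i ≠ j := fun h => Finset.disjoint_left.mp hdis hi (h ▸ hj)
    refine ⟨{i, j}, Finset.card_pair hij, ?_⟩
    rintro P ⟨a, ha, hea⟩ ⟨b, hb, heb⟩ ⟨c, hc, hdc⟩
    obtain rfl := hcell ha hc (hea hi) (hdc (by simp))
    obtain rfl := hcell hb hc (heb hj) (hdc (by simp))
    have h1 := Finset.card_le_card (Finset.union_subset hea heb)
    rw [Finset.card_union_of_disjoint hdis, he, he', P.2.2 _ ha] at h1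
    norm_num at h1
  -- For pairs meeting in `i`, let `d` join `i` to a point `j` outside `e ∪ e'`: again some cell
  -- would have at least four points.
  · obtain ⟨i, hi, hi'⟩ := Finset.not_disjoint_iff.mp hdis
    have hcard : 3 ≤ (e ∪ e').card := by
      by_contra! h
      have h1 := Finset.eq_of_subset_of_card_le (Finset.subset_union_left (s₁ := e) (s₂ := e'))
        (by omega)
      have h2 := Finset.eq_of_subset_of_card_le (Finset.subset_union_right (s₁ := e) (s₂ := e'))
        (by omega)
      exact hne (h1.trans h2.symm)
    have hlt : (e ∪ e').card < (Finset.univ : Finset (Fin 9)).card := by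
      have := Finset.card_union_le e e'
      simp only [Finset.card_univ, Fintype.card_fin]
      omega
    obtain ⟨j, -, hj⟩ := Finset.exists_mem_notMem_of_card_lt_card hlt
    have hij : i ≠ j := fun h => hj (h ▸ Finset.mem_union_left _ hi)
    refine ⟨{i, j}, Finset.card_pair hij, ?_⟩
    rintro P ⟨a, ha, hea⟩ ⟨b, hb, heb⟩ ⟨c, hc, hdc⟩
    obtain rfl := hcell ha hc (hea hi) (hdc (by simp))
    obtain rfl := hcell hb hc (heb hi') (hdc (by simp))
    have h1 := Finset.card_le_card
      (Finset.insert_subset (hdc (by simp : j ∈ {i, j})) (Finset.union_subset hea heb))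
    rw [Finset.card_insert_of_notMem hj, P.2.2 _ ha] at h1
    omega

/-- If `{x, y, z}` is a cell of `P`, then the cells of `Q` covering `{x, y}` and `{x, z}` share `x`,
so they coincide and equal `{x, y, z}`. One implication suffices because both partitions have three
cells. -/
theorem eq_of_covers_iff {P Q : TriplePartition}
    (h : ∀ e : Finset (Fin 9), e.card = 2 → P.Covers e → Q.Covers e) : P = Q := by
  apply Subtype.ext
  apply Finpartition.ext
  refine Finset.eq_of_subset_of_card_le (fun c hc => ?_) (by rw [P.2.1, Q.2.1])
  obtain ⟨x, y, z, hxy, hxz, hyz, rfl⟩ := Finset.card_eq_three.mp (P.2.2 c hc)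
  obtain ⟨a, ha, hxya⟩ := h {x, y} (Finset.card_pair hxy) ⟨_, hc, by grind⟩
  obtain ⟨b, hb, hxzb⟩ := h {x, z} (Finset.card_pair hxz) ⟨_, hc, by grind⟩
  obtain rfl := Q.1.eq_of_mem_parts ha hb (hxya (by simp : x ∈ _)) (hxzb (by simp))
  have hsub : {x, y, z} ⊆ a := by grind
  rwa [Finset.eq_of_subset_of_card_le hsub (by rw [Q.2.2 a ha, P.2.2 _ hc])]

theorem injective_skewGraph_hom (f : skewGraph →g skewGraph) : Function.Injective f := by
  choose g hg hfg using fun e : {e : Finset (Fin 9) // e.card = 2} =>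
    ((meetsCliques_covers e.2).comp f).exists_iff_covers
  let g' : {e : Finset (Fin 9) // e.card = 2} → {e : Finset (Fin 9) // e.card = 2} :=
    fun e => ⟨g e, hg e⟩
  have hinj : Function.Injective g' := by
    intro e e' h
    by_contra hne
    obtain ⟨d, hd, hcov⟩ := exists_pair_not_covers e.2 e'.2 (fun h => hne (Subtype.ext h))
    -- The image of this `P` covers `e`, `e'` and `d`, against the choice of `d`.
    obtain ⟨P, hP, hPd⟩ := exists_covers_pair_pair (hg e) (hg ⟨d, hd⟩)
    have h' : g e = g e' := congrArg Subtype.val h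
    exact hcov (f P) ((hfg e P).mpr hP) ((hfg e' P).mpr (h' ▸ hP)) ((hfg ⟨d, hd⟩ P).mpr hPd)
  intro P Q hPQ
  refine eq_of_covers_iff fun e he hP => ?_
  -- As every pair has the form `g e'`, whether `P` covers it depends only on `f P`.
  obtain ⟨e', he'⟩ := Finite.surjective_of_injective hinj ⟨e, he⟩
  obtain rfl : g e' = e := congrArg Subtype.val he'
  rw [← hfg] at hP ⊢
  rwa [← hPQ]

/-- An injective endomorphism of a finite graph is an automorphism. -/
theorem SimpleGraph.exists_iso_of_injective {V : Type*} [Finite V] {G : SimpleGraph V}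
    (f : G →g G) (hf : Function.Injective f) : ∃ φ : G ≃g G, ∀ v, φ v = f v := by
  let σ : Equiv.Perm V := Equiv.ofBijective f (Finite.injective_iff_bijective.mp hf)
  have hpow (n : ℕ) {v w : V} (h : G.Adj v w) : G.Adj ((σ ^ n) v) ((σ ^ n) w) := by
    induction n with
    | zero => exact h
    | succ n ih =>
      rw [pow_succ', Equiv.Perm.mul_apply, Equiv.Perm.mul_apply]
      exact f.map_adj ih
  refine ⟨⟨σ, fun {v w} => ⟨fun h => ?_, fun h => f.map_adj h⟩⟩, fun v => rfl⟩
  -- The inverse of `σ` is a power of `σ`, so it preserves adjacency as well.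
  have h' := hpow (orderOf σ - 1) h
  rw [← Equiv.Perm.mul_apply, ← Equiv.Perm.mul_apply, ← pow_succ,
    Nat.sub_add_cancel (orderOf_pos σ), pow_orderOf_eq_one] at h'
  exact h'

theorem mainTheorem1 : Nat.card TriplePartition = 280 ∧ skewGraph.IsCore :=
  ⟨card_triplePartition, fun f => SimpleGraph.exists_iso_of_injective f (injective_skewGraph_hom f)⟩
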